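/- \textbf{Methods.} For an autonomous system $y'=f(y)$ in $\mathbb{R}^N$ and an arbitrary matrix $\mathbf{A}\in\mathbb{R}^{N\times N}$ (an approximation of the Jacobian of $f$ at $y_n$), a three-stage EPIRK-$W$ method with coefficients $a,b,g,p$ performs the step \begin{align*} Y_1 &= y_n + a_{1,1}\,\psi_1(g_{1,1}h\mathbf{A})\,hf(y_n),\\ Y_2 &= y_n + a_{2,1}\,\psi_1(g_{2,1}h\mathbf{A})\,hf(y_n) + a_{2,2}\,\psi_2(g_{2,2}h\mathbf{A})\,h\Delta^{(1)}r(y_n),\\ y_{n+1} &= y_n + b_1\,\psi_1(g_{3,1}h\mathbf{A})\,hf(y_n) + b_2\,\psi_2(g_{3,2}h\mathbf{A})\,h\Delta^{(1)}r(y_n) + b_3\,\psi_3(g_{3,3}h\mathbf{A})\,h\Delta^{(2)}r(y_n), \end{align*} where $\psi_j(z)=\sum_{k=1}^{j}p_{j,k}\varphi_k(z)$, $\varphi_k(z)=\sum_{i\ge 0} z^i/(i+k)!$, $r(y)=f(y)-f(y_n)-\mathbf{A}(y-y_n)$, $\Delta^{(1)}r(y_n)=r(Y_1)-r(y_n)$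 and $\Delta^{(2)}r(y_n)=r(Y_2)-2r(Y_1)+r(y_n)$. An embedded method uses the same $a,g,p$ and other weights $\widehat b$. \textbf{Order conditions.} TW-trees are rooted trees (without ordering of the children) with meagre and fat nodes whose end vertices are meagre and whose fat vertices have exactly one child. Write $[\tau_1,\dots,\tau_m]$ for the tree with a meagre root and children $\tau_1,\dots,\tau_m$, and $[\tau]_{\circ}$ for the tree with a fat root and child $\tau$; $|\tau|$ is the number of nodes, and $\gamma(\tau)$ (the density) is the product over all vertices of the orders of the subtrees rooted there. A coefficient map $u$ on TW-trees stands for the formal series $\sum_\tau u(\tau)\frac{h^{|\tau|}}{\sigma(\tau)}F(\tau)(y_n)$, where $\sigma(\tau)$ is the order of the symmetry group of $\tau$ and $F(\tau)$ is the elementary differential in which meagre nodes stand for derivatives of $f$ and fat nodes for $\mathbf{A}$. If $Y-y_n$ has coefficients $u$, then $hf(Y)$ has coefficients $[\tau_1,\dots,\tau_m]\mapsto u(\tau_1)\cdots u(\tau_m)$, $[\tau]_\circ\mapsto 0$, and $h\mathbf{A}(Y-y_n)$ has coefficients $[\tau_1,\dots,\tau_m]\mapsto 0$, $[\tau]_\circ\mapsto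 u(\tau)$. Applying these rules, linearity and the power series of $\psi_j$ to the formulas of the method gives the coefficients of $y_{n+1}-y_n$. Those of the exact increment $y(t_n+h)-y(t_n)$, with $y(t_n)=y_n$, are $1/\gamma(\tau)$ if all nodes of $\tau$ are meagre and $0$ otherwise. The order condition of $\tau$ says that the two coefficients of $\tau$ agree; their difference is called the residual. There are exactly eight TW-trees with $|\tau|\le 3$. The method \emph{has order $q$ for an arbitrary Jacobian approximation} if for every $N$, every matrix $\mathbf{A}$, every $f$ of class $C^q$ near $y(t)$ and every solution $y$ of $y'=f(y)$ on an interval $[t,t+\delta]$, $\delta>0$, one step of size $h$ from $y(t)$ differs from $y(t+h)$ by $O(h^{q+1})$ as $h\to 0^+$. \textbf{Claim.} (a) The method \textsc{epirkw3a} with $$a=\begin{bmatrix}\frac12&0&0\\0&1&0\end{bmatrix},\quad b=\begin{bmatrix}\frac34&\frac12&1\end{bmatrix},\quad g=\begin{bmatrix}\frac23&0&0\\0&0&0\\1&\frac35&0\end{bmatrix},\quad p=\begin{bmatrix}\frac43&0&0\\1&2&0\\0&0&\frac34\end{bmatrix}$$ satisfies the eight order conditions for TW-trees up to order three, and it has order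 three for an arbitrary Jacobian approximation. For every real $\beta$, the embedded weights $\widehat b=(\frac34,\beta,8\beta-3)$ (for example $(\frac34,\frac34,3)$) satisfy the conditions up to order two, and the embedded method has order two for an arbitrary Jacobian approximation. (b) Let $a_{2,1}=0.45648365922343240794$, $a_{2,2}=0.33161664063356950085$ and $$b_2=-\frac{a_{2,2}(3a_{2,1}-4)}{2a_{2,1}^2},\quad b_3=-\frac{3a_{2,1}-4}{10\,a_{2,1}^2},\quad g_{2,1}=-\frac{2a_{2,1}}{3a_{2,1}-4},\quad p_{2,2}=-\frac{4a_{2,1}}{a_{2,2}(3a_{2,1}-4)}.$$ The method \textsc{epirkw3b} with $$a=\begin{bmatrix}\frac{a_{2,1}}2&0&0\\a_{2,1}&a_{2,2}&0\end{bmatrix},\quad b=\begin{bmatrix}1&b_2&b_3\end{bmatrix},\quad g=\begin{bmatrix}0&0&0\\g_{2,1}&g_{2,1}&g_{2,1}\\1&1&1\end{bmatrix},\quad p=\begin{bmatrix}1&0&0\\0&p_{2,2}&0\\1&1&1\end{bmatrix}$$ satisfies the eight order conditions for TW-trees up to order three, and it has order three for an arbitrary Jacobian approximation. For every real $\beta$,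 the embedded weights $\widehat b=(1,b_2,\beta)$ (in particular $\beta=1$) satisfy the conditions up to order two, and the embedded method has order two for an arbitrary Jacobian approximation. (c) The decimal values $a_{1,1}=0.22824182961171620396$, $a_{2,1}$ and $a_{2,2}$ as in (b), $b=(1,\ 2.0931591383832578214,\ 1.2623969257900804404)$, $\widehat b=(1,\ 2.0931591383832578214,\ 1)$, $g_{2,j}=0.34706341174296320958$ $(j=1,2,3)$, $p_{2,2}=2.0931604100438501004$, with all other entries as in (b), agree with the coefficients in (b) (with $\beta=1$ in $\widehat b$) to within $10^{-14}$. With these decimals, each of the eight residuals up to order three for $b$, and each residual up to order two for $\widehat b$, is at most $10^{-14}$ in absolute value. -/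

import Mathlib

open Filter Topology Asymptotics

namespace EPIRKW

/-! ### TW-trees -/

/-- Rooted trees with meagre and fat nodes, the children of a node being listed in some order.
End vertices are meagre and fat vertices are singly branched. -/
inductive OrderedTree : Type
  | meagre : List OrderedTree → OrderedTree
  | fat : OrderedTree → OrderedTree

/-- Two ordered trees differ by rearranging the children of one node. -/
inductive Rearranged : OrderedTree → OrderedTree → Prop
  | perm {l l' : List OrderedTree} (h : l.Perm l') : Rearranged (.meagre l) (.meagre l')
  | child (l₁ l₂ : List OrderedTree) {t t' : OrderedTree} (h : Rearranged t t') :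
      Rearranged (.meagre (l₁ ++ t :: l₂)) (.meagre (l₁ ++ t' :: l₂))
  | fat {t t' : OrderedTree} (h : Rearranged t t') : Rearranged (.fat t) (.fat t')

/-- TW-trees: the order of the children of a node is forgotten. -/
def TWTree : Type := Quot Rearranged

namespace OrderedTree

/-- The number of nodes. -/
def order : OrderedTree → ℕ
  | .meagre l => 1 + (l.map order).sum
  | .fat t => 1 + order t

/-- The product over all vertices of the orders of the subtrees rooted at those vertices. -/
def density : OrderedTree → ℕ
  | .meagre l => order (.meagre l) * (l.map density).prod
  | .fat t => order (.fat t) * density t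

/-- All nodes are meagre, i.e. the tree is an ordinary Butcher tree. -/
def AllMeagre : OrderedTree → Prop
  | .meagre l => ∀ t ∈ l, AllMeagre t
  | .fat _ => False

theorem order_congr {s t : OrderedTree} (h : Rearranged s t) : s.order = t.order := by
  induction h with
  | perm h => simp only [order]; rw [(h.map order).sum_eq]
  | child l₁ l₂ h ih => simp [order, ih]
  | fat h ih => simp [order, ih]

theorem density_congr {s t : OrderedTree} (h : Rearranged s t) : s.density = t.density := by
  induction h with
  | perm h => simp only [density, order]; rw [(h.map order).sum_eq, (h.map density).prod_eq]
  | child l₁ l₂ h ih => simp [density, order, ih, order_congr h]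
  | fat h ih => simp [density, order, ih, order_congr h]

theorem allMeagre_congr {s t : OrderedTree} (h : Rearranged s t) :
    s.AllMeagre ↔ t.AllMeagre := by
  induction h with
  | perm h => simp only [AllMeagre, h.mem_iff]
  | child l₁ l₂ h ih => simp [AllMeagre, or_imp, forall_and, ih]
  | fat h ih => simp [AllMeagre]

end OrderedTree

namespace TWTree

def order : TWTree → ℕ := Quot.lift OrderedTree.order fun _ _ h => OrderedTree.order_congr h

def density : TWTree → ℕ := Quot.lift OrderedTree.density fun _ _ h => OrderedTree.density_congr h

def AllMeagre : TWTree → Prop :=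
  Quot.lift OrderedTree.AllMeagre fun _ _ h => propext (OrderedTree.allMeagre_congr h)

end TWTree

/-! ### B-series

A coefficient map `u : TWTree → ℝ` stands for the formal series
`∑ τ, u τ * h ^ |τ| / σ(τ) * F(τ)(yₙ)`, where `F(τ)` is the elementary differential of `τ`
(a meagre node stands for a derivative of `f`, a fat node for the matrix `A`) and `σ(τ)` is the
order of the symmetry group of `τ`.  A series with coefficient `1` on the empty tree, such as a
stage vector `Y`, is represented by the coefficients `u` of `Y - yₙ`. -/

abbrev Coeff : Type := TWTree → ℝ

noncomputable section

/-- Coefficients of `h f(yₙ + B(u))`: a tree with meagre root and children `t₁, …, tₘ` receives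
`u t₁ * ⋯ * u tₘ`, a tree with fat root receives `0`. -/
def compF (u : Coeff) : Coeff :=
  Quot.lift
    (fun s => match s with
      | .meagre l => (l.map fun t => u (Quot.mk _ t)).prod
      | .fat _ => 0)
    (by
      intro s t h
      cases h with
      | perm h => exact (h.map _).prod_eq
      | child l₁ l₂ h => simp [Quot.sound h]
      | fat h => rfl)

/-- Coefficients of `h A B(u)`: a tree with fat root and child `t` receives `u t`, a tree with
meagre root receives `0`. -/
def mulA (u : Coeff) : Coeff :=
  Quot.lift
    (fun s => match s with
      | .meagre _ => 0
      | .fat t => u (Quot.mk _ t))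
    (by
      intro s t h
      cases h with
      | perm h => rfl
      | child l₁ l₂ h => rfl
      | fat h => exact congrArg u (Quot.sound h))

/-- Coefficients of `(∑ i, c i • (h A) ^ i) B(u)`.  On a tree `τ` only powers `i < |τ|`
contribute, as a tree carries at least one node above a chain of fat nodes. -/
def mulSeries (c : ℕ → ℝ) (u : Coeff) : Coeff := fun τ =>
  ∑ i ∈ Finset.range τ.order, c i * (mulA^[i] u) τ

/-- Coefficients of `h r(yₙ + B(u))`, where `r(y) = f(y) - f(yₙ) - A (y - yₙ)`. -/
def compR (u : Coeff) : Coeff := compF u - compF 0 - mulA u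

/-- Coefficients of `y(tₙ + h) - yₙ` for the exact solution `y`. -/
def exactCoeff : Coeff := fun τ =>
  open Classical in if τ.AllMeagre then 1 / (τ.density : ℝ) else 0

/-! ### Three-stage EPIRK-W methods -/

/-- The coefficients of a three-stage EPIRK-W method.  The indices `0, 1, 2` of the code stand for
`1, 2, 3`. -/
structure Tableau where
  a : Matrix (Fin 2) (Fin 3) ℝ
  b : Fin 3 → ℝ
  g : Matrix (Fin 3) (Fin 3) ℝ
  p : Matrix (Fin 3) (Fin 3) ℝ

/-- The method with other output weights and all other coefficients unchanged. -/
def Tableau.withWeights (T : Tableau) (b : Fin 3 → ℝ) : Tableau := { T with b := b }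

/-- `φₖ(X) = ∑ i, X ^ i / (i + k)!`. -/
def phi {N : ℕ} (k : ℕ) (X : EuclideanSpace ℝ (Fin N) →L[ℝ] EuclideanSpace ℝ (Fin N)) :
    EuclideanSpace ℝ (Fin N) →L[ℝ] EuclideanSpace ℝ (Fin N) :=
  ∑' i : ℕ, ((i + k).factorial : ℝ)⁻¹ • X ^ i

namespace Tableau

variable (T : Tableau)

/-- `ψⱼ(X) = ∑ k ≤ j, p j k • φₖ(X)`. -/
def psi {N : ℕ} (j : Fin 3)
    (X : EuclideanSpace ℝ (Fin N) →L[ℝ] EuclideanSpace ℝ (Fin N)) :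
    EuclideanSpace ℝ (Fin N) →L[ℝ] EuclideanSpace ℝ (Fin N) :=
  ∑ k ∈ Finset.Iic j, T.p j k • phi (k.val + 1) X

section Step

variable {N : ℕ} (f : EuclideanSpace ℝ (Fin N) → EuclideanSpace ℝ (Fin N))
  (A : EuclideanSpace ℝ (Fin N) →L[ℝ] EuclideanSpace ℝ (Fin N)) (h : ℝ)
  (y₀ : EuclideanSpace ℝ (Fin N))

/-- `r(y) = f(y) - f(yₙ) - A (y - yₙ)`. -/
def _root_.EPIRKW.remainder (y : EuclideanSpace ℝ (Fin N)) : EuclideanSpace ℝ (Fin N) :=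
  f y - f y₀ - A (y - y₀)

/-- The first internal stage `Y₁`. -/
def stage₁ : EuclideanSpace ℝ (Fin N) :=
  y₀ + T.a 0 0 • T.psi 0 ((T.g 0 0 * h) • A) (h • f y₀)

/-- `Δ⁽¹⁾ r(yₙ) = r(Y₁) - r(yₙ)`. -/
def diff₁ : EuclideanSpace ℝ (Fin N) :=
  remainder f A y₀ (T.stage₁ f A h y₀) - remainder f A y₀ y₀

/-- The second internal stage `Y₂`. -/
def stage₂ : EuclideanSpace ℝ (Fin N) :=
  y₀ + T.a 1 0 • T.psi 0 ((T.g 1 0 * h) • A) (h • f y₀)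
    + T.a 1 1 • T.psi 1 ((T.g 1 1 * h) • A) (h • T.diff₁ f A h y₀)

/-- `Δ⁽²⁾ r(yₙ) = (r(Y₂) - r(Y₁)) - (r(Y₁) - r(yₙ))`. -/
def diff₂ : EuclideanSpace ℝ (Fin N) :=
  (remainder f A y₀ (T.stage₂ f A h y₀) - remainder f A y₀ (T.stage₁ f A h y₀))
    - T.diff₁ f A h y₀

/-- One step `yₙ ↦ yₙ₊₁` of size `h` of the method for `y' = f(y)`, with the matrix `A` in the
place of the Jacobian. -/
def step : EuclideanSpace ℝ (Fin N) :=
  y₀ + T.b 0 • T.psi 0 ((T.g 2 0 * h) • A) (h • f y₀)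
    + T.b 1 • T.psi 1 ((T.g 2 1 * h) • A) (h • T.diff₁ f A h y₀)
    + T.b 2 • T.psi 2 ((T.g 2 2 * h) • A) (h • T.diff₂ f A h y₀)

end Step

/-! The B-series coefficients of the numerical solution, by the corresponding operations on
coefficient maps. -/

/-- Coefficients of `ψⱼ(g h A) B(u)`. -/
def psiCoeff (j : Fin 3) (g : ℝ) (u : Coeff) : Coeff :=
  mulSeries
    (fun i => (∑ k ∈ Finset.Iic j, T.p j k * ((i + (k.val + 1)).factorial : ℝ)⁻¹) * g ^ i) u

/-- Coefficients of `Y₁ - yₙ`. -/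
def stageCoeff₁ : Coeff := T.a 0 0 • T.psiCoeff 0 (T.g 0 0) (compF 0)

/-- Coefficients of `h Δ⁽¹⁾ r(yₙ)`. -/
def diffCoeff₁ : Coeff := compR T.stageCoeff₁ - compR 0

/-- Coefficients of `Y₂ - yₙ`. -/
def stageCoeff₂ : Coeff :=
  T.a 1 0 • T.psiCoeff 0 (T.g 1 0) (compF 0) + T.a 1 1 • T.psiCoeff 1 (T.g 1 1) T.diffCoeff₁

/-- Coefficients of `h Δ⁽²⁾ r(yₙ)`. -/
def diffCoeff₂ : Coeff := (compR T.stageCoeff₂ - compR T.stageCoeff₁) - T.diffCoeff₁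

/-- Coefficients of `yₙ₊₁ - yₙ`. -/
def stepCoeff : Coeff :=
  T.b 0 • T.psiCoeff 0 (T.g 2 0) (compF 0) + T.b 1 • T.psiCoeff 1 (T.g 2 1) T.diffCoeff₁
    + T.b 2 • T.psiCoeff 2 (T.g 2 2) T.diffCoeff₂

/-- The defect in the order condition of the tree `τ`. -/
def residual (τ : TWTree) : ℝ := T.stepCoeff τ - exactCoeff τ

/-- The order conditions of all TW-trees with at most `q` nodes hold. -/
def SatisfiesOrderConditions (q : ℕ) : Prop := ∀ τ : TWTree, τ.order ≤ q → T.residual τ = 0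

/-- The method has order `q` for an arbitrary Jacobian approximation `A`: in every dimension, for
every matrix `A`, every right-hand side `f` of class `C^q` near the current value and every
solution `y` of `y' = f(y)` on an interval `[t, t + δ]`, one step of size `h` from `y(t)` differs
from `y(t + h)` by `O(h ^ (q + 1))`. -/
def HasOrder (q : ℕ) : Prop :=
  ∀ (N : ℕ) (f : EuclideanSpace ℝ (Fin N) → EuclideanSpace ℝ (Fin N))
    (A : EuclideanSpace ℝ (Fin N) →L[ℝ] EuclideanSpace ℝ (Fin N))
    (y : ℝ → EuclideanSpace ℝ (Fin N)) (t δ : ℝ),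
    0 < δ → ContDiffAt ℝ q f (y t) →
    (∀ s ∈ Set.Icc t (t + δ), HasDerivWithinAt y (f (y s)) (Set.Icc t (t + δ)) s) →
    (fun h : ℝ => T.step f A h (y t) - y (t + h)) =O[𝓝[>] 0] fun h : ℝ => h ^ (q + 1)

end Tableau

/-! ### The two coefficient sets -/

/-- `epirkw3a`. -/
def epirkw3a : Tableau where
  a := !![1 / 2, 0, 0; 0, 1, 0]
  b := ![3 / 4, 1 / 2, 1]
  g := !![2 / 3, 0, 0; 0, 0, 0; 1, 3 / 5, 0]
  p := !![4 / 3, 0, 0; 1, 2, 0; 0, 0, 3 / 4]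

/-- The embedded weights of `epirkw3a`, with the free parameter `β`. -/
def epirkw3aEmbedded (β : ℝ) : Fin 3 → ℝ := ![3 / 4, β, 8 * β - 3]

/-- `epirkw3b` as displayed, in decimals. -/
def epirkw3bDecimal : Tableau where
  a := !![0.22824182961171620396, 0, 0; 0.45648365922343240794, 0.33161664063356950085, 0]
  b := ![1, 2.0931591383832578214, 1.2623969257900804404]
  g := !![0, 0, 0;
    0.34706341174296320958, 0.34706341174296320958, 0.34706341174296320958;
    1, 1, 1]
  p := !![1, 0, 0; 0, 2.0931604100438501004, 0; 1, 1, 1]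

/-- The embedded weights of `epirkw3b` as displayed, in decimals. -/
def epirkw3bEmbeddedDecimal : Fin 3 → ℝ := ![1, 2.0931591383832578214, 1]

/-- The coefficient `a₂₁` of `epirkw3b`. -/
def a₂₁ : ℝ := 0.45648365922343240794

/-- The coefficient `a₂₂` of `epirkw3b`. -/
def a₂₂ : ℝ := 0.33161664063356950085

/-- The coefficient `b₂` of `epirkw3b`. -/
def b₂ : ℝ := -(a₂₂ * (3 * a₂₁ - 4)) / (2 * a₂₁ ^ 2)

/-- The coefficient `g₂₁ = g₂₂ = g₂₃` of `epirkw3b`. -/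
def g₂₁ : ℝ := -(2 * a₂₁) / (3 * a₂₁ - 4)

/-- `epirkw3b` in closed form: the member with `g₁₁ = 0`, `p₁₁ = p₃₁ = p₃₂ = p₃₃ = 1` and the above
values of `a₂₁`, `a₂₂` of the family from which the decimals are computed. -/
def epirkw3b : Tableau where
  a := !![a₂₁ / 2, 0, 0; a₂₁, a₂₂, 0]
  b := ![1, b₂, -(3 * a₂₁ - 4) / (10 * a₂₁ ^ 2)]
  g := !![0, 0, 0; g₂₁, g₂₁, g₂₁; 1, 1, 1]
  p := !![1, 0, 0; 0, -(4 * a₂₁) / (a₂₂ * (3 * a₂₁ - 4)), 0; 1, 1, 1]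

/-- The embedded weights of `epirkw3b`, with the free parameter `β` (displayed value `1`). -/
def epirkw3bEmbedded (β : ℝ) : Fin 3 → ℝ := ![1, b₂, β]

/-- All coefficients of the two methods agree up to `ε`. -/
def Tableau.Near (S T : Tableau) (ε : ℝ) : Prop :=
  (∀ i j, |S.a i j - T.a i j| ≤ ε) ∧ (∀ j, |S.b j - T.b j| ≤ ε) ∧
    (∀ i j, |S.g i j - T.g i j| ≤ ε) ∧ (∀ i j, |S.p i j - T.p i j| ≤ ε)

end

end EPIRKW

/-! The order conditions imply the order because the numerical and the exact increment are, up to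
`O(h ^ (q + 1))`, truncated B-series over the same elementary differentials. If their coefficients
agree on all trees with at most `q` nodes, the two truncations differ only by `O(h ^ (q + 1))`.

For the numerical step, each operation of the method is matched with its rule on coefficients
(`IsBSeries.compF`, `IsBSeries.mulA`, `IsBSeries.mulSeries`). The factor `h` in `h f` and `h A`
gains one order, so a Taylor remainder `O(‖x‖ ^ q)` of `f` is enough, and this is what `C^q` gives.
The matrix `A` is never compared with the Jacobian: it has its own (fat) nodes.

For the exact solution, `|τ| e(τ) = compF e(τ)` is the differential equation read on coefficients.
Substituting an expansion into `f` and integrating improves it by one order, so induction gives all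
the orders needed (`isBSeries_exactCoeff`).

What remains is finite. There are eight trees, and the residuals on them are explicit polynomials in
the coefficients of the method. They vanish by direct computation for `epirkw3a`, and as rational
identities in `a₂₁`, `a₂₂` for `epirkw3b`. The decimals are checked in exact rational arithmetic. -/

namespace EPIRKW

/-! ### The TW-trees with at most three nodes -/

namespace TWTree

/-- The TW-trees with at most three nodes. -/
def small : Fin 8 → TWTree := fun i => Quot.mk _ <|
  (![.meagre [], .meagre [.meagre []], .fat (.meagre []), .meagre [.meagre [], .meagre []],
    .meagre [.meagre [.meagre []]], .meagre [.fat (.meagre [])], .fat (.meagre [.meagre []]),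
    .fat (.fat (.meagre []))] : Fin 8 → OrderedTree) i

theorem order_mk (t : OrderedTree) : TWTree.order (Quot.mk _ t) = t.order := rfl

theorem order_small (i : Fin 8) : (small i).order = ![1, 2, 2, 3, 3, 3, 3, 3] i := by
  fin_cases i <;> simp [small, order_mk, OrderedTree.order]

end TWTree

theorem OrderedTree.order_pos (t : OrderedTree) : 0 < t.order := by
  cases t <;> simp [OrderedTree.order]

theorem TWTree.order_pos (τ : TWTree) : 0 < τ.order := by
  induction τ using Quot.ind
  exact OrderedTree.order_pos _

theorem OrderedTree.eq_of_order_le_one {t : OrderedTree} (h : t.order ≤ 1) : t = .meagre [] := by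
  rcases t with l | t
  · rcases l with _ | ⟨s, l⟩
    · rfl
    · have := s.order_pos
      simp [OrderedTree.order] at h
      omega
  · have := t.order_pos
    simp [OrderedTree.order] at h
    omega

theorem OrderedTree.eq_of_order_le_two {t : OrderedTree} (h : t.order ≤ 2) :
    t = .meagre [] ∨ t = .meagre [.meagre []] ∨ t = .fat (.meagre []) := by
  rcases t with l | t
  · rcases l with _ | ⟨s, _ | ⟨s', l⟩⟩
    · exact .inl rfl
    · rw [OrderedTree.eq_of_order_le_one (t := s) (by simp [OrderedTree.order] at h; omega)]
      simp
    · have := s.order_pos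
      have := s'.order_pos
      simp [OrderedTree.order] at h
      omega
  · rw [OrderedTree.eq_of_order_le_one (t := t) (by simp [OrderedTree.order] at h; omega)]
    simp

theorem TWTree.exists_eq_small {τ : TWTree} (h : τ.order ≤ 3) : ∃ i, τ = small i := by
  induction τ using Quot.ind with | _ t
  rw [TWTree.order_mk] at h
  rcases t with l | t
  · rcases l with _ | ⟨s, _ | ⟨s', _ | ⟨s'', l⟩⟩⟩
    · exact ⟨0, rfl⟩
    · obtain rfl | rfl | rfl := OrderedTree.eq_of_order_le_two (t := s)
        (by simp [OrderedTree.order] at h; omega)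
      exacts [⟨1, rfl⟩, ⟨4, rfl⟩, ⟨5, rfl⟩]
    · have := s.order_pos
      have := s'.order_pos
      simp [OrderedTree.order] at h
      obtain rfl := OrderedTree.eq_of_order_le_one (t := s) (by omega)
      obtain rfl := OrderedTree.eq_of_order_le_one (t := s') (by omega)
      exact ⟨3, rfl⟩
    · have := s.order_pos
      have := s'.order_pos
      have := s''.order_pos
      simp [OrderedTree.order] at h
      omega
  · obtain rfl | rfl | rfl := OrderedTree.eq_of_order_le_two (t := t)
        (by simp [OrderedTree.order] at h; omega)
    exacts [⟨2, rfl⟩, ⟨6, rfl⟩, ⟨7, rfl⟩]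

/-! ### Coefficient maps on the eight small trees -/

section Evaluation

variable (u : Coeff)

/-- The values of a coefficient map on the trees with at most three nodes determine those of
`compF`. -/
theorem compF_small (i : Fin 8) : compF u (TWTree.small i) =
    ![1, u (.small 0), 0, u (.small 0) ^ 2, u (.small 1), u (.small 2), 0, 0] i := by
  fin_cases i <;> simp [TWTree.small, compF, sq]

theorem mulA_small (i : Fin 8) : mulA u (TWTree.small i) =
    ![0, 0, u (.small 0), 0, 0, 0, u (.small 1), u (.small 2)] i := by
  fin_cases i <;> simp [TWTree.small, mulA]

/-- Removing three fat nodes from the root of a tree with at most three nodes is impossible, so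
powers beyond the second do not contribute. On smaller trees the surplus terms on the right are
zero. -/
theorem mulSeries_small (c : ℕ → ℝ) (i : Fin 8) : mulSeries c u (TWTree.small i) =
    c 0 * u (.small i) + c 1 * mulA u (.small i) + c 2 * mulA (mulA u) (.small i) := by
  fin_cases i <;>
    simp [mulSeries, TWTree.order_small, Finset.sum_range_succ, Function.iterate_succ, mulA_small]

theorem exactCoeff_small (i : Fin 8) : exactCoeff (TWTree.small i) =
    ![1, 1 / 2, 0, 1 / 3, 1 / 6, 0, 0, 0] i := by
  fin_cases i <;>
    simp [exactCoeff, TWTree.small, TWTree.AllMeagre, TWTree.density, OrderedTree.AllMeagre,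
      OrderedTree.density, OrderedTree.order]

/-- This is `h y' = h f(y)` on coefficients: differentiating `h ^ |τ|` and multiplying by `h`
produces the factor `|τ|`. -/
theorem order_mul_exactCoeff_small (i : Fin 8) :
    ((TWTree.small i).order : ℝ) * exactCoeff (.small i) = compF exactCoeff (.small i) := by
  rw [exactCoeff_small, compF_small, TWTree.order_small]
  fin_cases i <;> simp [exactCoeff_small]
  norm_num

end Evaluation

/-- Different ordered trees might be identified in the quotient, so an invariant has to separate
them. A meagre vertex gets the product of its children's values, each increased by 2; a fat vertex
gets 11 times the value of its child. Three applications of `s` compute this on every tree with at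
most three nodes, and the eight values are distinct. -/
theorem TWTree.small_injective : Function.Injective small := by
  let e : Coeff := fun _ => 1
  let s : Coeff → Coeff := fun u => compF (u + 2) + (11 : ℝ) • mulA u
  have hv : ∀ i, s (s (s e)) (small i) = (![1, 3, 11, 9, 5, 13, 33, 121] : Fin 8 → ℕ) i := by
    intro i
    fin_cases i <;> simp [s, e, compF_small, mulA_small] <;> norm_num
  have hinj : Function.Injective (![1, 3, 11, 9, 5, 13, 33, 121] : Fin 8 → ℕ) := by decide
  intro i j hij
  apply hinj
  have := hv i
  rw [hij, hv j] at this
  exact_mod_cast this.symm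

theorem TWTree.ncard_order_le_three : Set.ncard {τ : TWTree | τ.order ≤ 3} = 8 := by
  have : {τ : TWTree | τ.order ≤ 3} = Set.range small := by
    ext τ
    constructor
    · intro h
      obtain ⟨i, rfl⟩ := exists_eq_small h
      exact ⟨i, rfl⟩
    · rintro ⟨i, rfl⟩
      rw [Set.mem_ofPred_eq, order_small]
      fin_cases i <;> simp
  rw [this, ← Set.image_univ, Set.ncard_image_of_injective _ small_injective, Set.ncard_univ]
  simp

/-! ### Truncated B-series -/

section BSeries

variable {E : Type*} [NormedAddCommGroup E] [NormedSpace ℝ E]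

theorem isBigO_pow_nhdsGT {m n : ℕ} (h : m ≤ n) :
    (fun x : ℝ => x ^ n) =O[𝓝[>] 0] fun x => x ^ m := by
  refine IsBigO.mono ?_ nhdsWithin_le_nhds
  obtain rfl | h := h.eq_or_lt
  exacts [isBigO_refl _ _, (isLittleO_pow_pow h).isBigO]

/-- The elementary differentials of the trees `TWTree.small i`, divided by the orders of the
symmetry groups; `f₀`, `D₁`, `D₂` are the derivatives of the right-hand side of order
`0`, `1`, `2`. -/
noncomputable def elemDiff (f₀ : E) (D₁ A : E →L[ℝ] E) (D₂ : E →L[ℝ] E →L[ℝ] E) : Fin 8 → E :=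
  ![f₀, D₁ f₀, A f₀, (1 / 2 : ℝ) • D₂ f₀ f₀, D₁ (D₁ f₀), D₁ (A f₀), A (D₁ f₀), A (A f₀)]

/-- The B-series with coefficients `u`, truncated after the trees with three nodes. -/
noncomputable def bSum (F : Fin 8 → E) (u : Coeff) (h : ℝ) : E :=
  ∑ i, (h ^ (TWTree.small i).order * u (.small i)) • F i

/-- `v` is given by the B-series with coefficients `u`, up to `O(h ^ (m + 1))`. -/
def IsBSeries (F : Fin 8 → E) (m : ℕ) (u : Coeff) (v : ℝ → E) : Prop :=
  (fun h => v h - bSum F u h) =O[𝓝[>] 0] fun h => h ^ (m + 1)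

variable {F : Fin 8 → E} {m : ℕ} {u u' : Coeff} {v v' : ℝ → E}

theorem bSum_apply (F : Fin 8 → E) (u : Coeff) (h : ℝ) : bSum F u h =
    (h * u (.small 0)) • F 0 + (h ^ 2 * u (.small 1)) • F 1 + (h ^ 2 * u (.small 2)) • F 2
      + (h ^ 3 * u (.small 3)) • F 3 + (h ^ 3 * u (.small 4)) • F 4
      + (h ^ 3 * u (.small 5)) • F 5 + (h ^ 3 * u (.small 6)) • F 6
      + (h ^ 3 * u (.small 7)) • F 7 := by
  simp [bSum, Fin.sum_univ_eight, TWTree.order_small]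

theorem bSum_add (F : Fin 8 → E) (u u' : Coeff) (h : ℝ) :
    bSum F (u + u') h = bSum F u h + bSum F u' h := by
  simp [bSum, mul_add, add_smul, Finset.sum_add_distrib]

theorem bSum_smul (F : Fin 8 → E) (c : ℝ) (u : Coeff) (h : ℝ) :
    bSum F (c • u) h = c • bSum F u h := by
  simp only [bSum, Finset.smul_sum, smul_smul, Pi.smul_apply, smul_eq_mul]
  exact Finset.sum_congr rfl fun i _ => by ring_nf

theorem bSum_sub (F : Fin 8 → E) (u u' : Coeff) (h : ℝ) :
    bSum F (u - u') h = bSum F u h - bSum F u' h := by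
  simp [bSum, mul_sub, sub_smul, Finset.sum_sub_distrib]

theorem bSum_congr (h : ℝ) (huu' : ∀ i, u (.small i) = u' (.small i)) :
    bSum F u h = bSum F u' h := by
  simp [bSum, huu']

theorem IsBSeries.add (h : IsBSeries F m u v) (h' : IsBSeries F m u' v') :
    IsBSeries F m (u + u') fun x => v x + v' x := by
  refine (IsBigO.add h h').congr_left fun x => ?_
  rw [bSum_add, add_sub_add_comm]

theorem IsBSeries.sub (h : IsBSeries F m u v) (h' : IsBSeries F m u' v') :
    IsBSeries F m (u - u') fun x => v x - v' x := by
  refine (IsBigO.sub h h').congr_left fun x => ?_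
  rw [bSum_sub, sub_sub_sub_comm]

theorem IsBSeries.const_smul (h : IsBSeries F m u v) (c : ℝ) :
    IsBSeries F m (c • u) fun x => c • v x := by
  refine (IsBigO.const_smul_left h c).congr_left fun x => ?_
  simp only [Pi.smul_apply]
  rw [bSum_smul, smul_sub]

theorem IsBSeries.congr_coeff (h : IsBSeries F m u v)
    (huu' : ∀ i, u (.small i) = u' (.small i)) : IsBSeries F m u' v :=
  h.congr_left fun x => by rw [bSum_congr x huu']

theorem IsBSeries.mono {n : ℕ} (h : IsBSeries F m u v) (hn : n ≤ m) : IsBSeries F n u v :=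
  IsBigO.trans h (isBigO_pow_nhdsGT (by omega))

theorem isBSeries_bSum (F : Fin 8 → E) (m : ℕ) (u : Coeff) : IsBSeries F m u (bSum F u) := by
  simp [IsBSeries, isBigO_zero]

theorem isBSeries_zero (F : Fin 8 → E) (m : ℕ) : IsBSeries F m 0 fun _ => 0 := by
  simp [IsBSeries, bSum, isBigO_zero]

/-- A B-series whose coefficients vanish up to order `m` is `O(h ^ (m + 1))`. -/
theorem bSum_isBigO (h : ∀ i, (TWTree.small i).order ≤ m → u (.small i) = 0) :
    bSum F u =O[𝓝[>] 0] fun x => x ^ (m + 1) := by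
  refine IsBigO.fun_sum (s := Finset.univ)
    (A := fun i x => (x ^ (TWTree.small i).order * u (.small i)) • F i) fun i _ => ?_
  by_cases hi : (TWTree.small i).order ≤ m
  · simp [h i hi, isBigO_zero]
  · have h1 : (fun x : ℝ => x ^ (TWTree.small i).order) =O[𝓝[>] 0] fun x => x ^ (m + 1) :=
      isBigO_pow_nhdsGT (by omega)
    have h2 : (fun _ : ℝ => u (.small i) • F i) =O[𝓝[>] 0] fun _ => (1 : ℝ) :=
      isBigO_const_const _ one_ne_zero _
    simpa [mul_smul] using h1.smul h2

theorem IsBSeries.isBigO (h : IsBSeries F m u v)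
    (hu : ∀ i, (TWTree.small i).order ≤ m → u (.small i) = 0) :
    v =O[𝓝[>] 0] fun x => x ^ (m + 1) := by
  simpa using IsBigO.add h (bSum_isBigO (F := F) hu)

theorem IsBSeries.isBigO_id (h : IsBSeries F m u v) : v =O[𝓝[>] 0] fun x => x := by
  have := (h.mono (Nat.zero_le m)).isBigO fun i hi =>
    absurd (TWTree.order_pos (.small i)) (by omega)
  simpa using this

/-- A B-series of order `0` is just a quantity of size `O(h)`. -/
theorem isBSeries_zero_iff : IsBSeries F 0 u v ↔ v =O[𝓝[>] 0] fun x => x := by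
  refine ⟨fun h => h.isBigO_id, fun h => ?_⟩
  have := h.sub (isBSeries_bSum F 0 u).isBigO_id
  simpa [IsBSeries] using this

variable {f₀ : E} {D₁ A : E →L[ℝ] E} {D₂ : E →L[ℝ] E →L[ℝ] E}

/-- A bounded operator preserves the error order and the factor `x` adds one. This serves both `A`
and the derivative `D₁`. -/
theorem IsBSeries.clm_isBigO (h : IsBSeries F m u v) (L : E →L[ℝ] E) :
    (fun x => x • L (v x) - x • L (bSum F u x)) =O[𝓝[>] 0] fun x => x ^ (m + 2) := by
  have h1 := (isBigO_refl (fun x : ℝ => x) (𝓝[>] 0)).smul ((L.isBigO_comp _ _).trans h)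
  refine (h1.congr_left fun x => ?_).congr_right fun x => ?_
  · simp [smul_sub]
  · simp only [smul_eq_mul]; ring

/-- Multiplication by `h A`. -/
theorem IsBSeries.mulA (hm : m ≤ 2) (h : IsBSeries (elemDiff f₀ D₁ A D₂) m u v) :
    IsBSeries (elemDiff f₀ D₁ A D₂) (m + 1) (mulA u) fun x => x • A (v x) := by
  have h4 : (fun x : ℝ => x ^ 4) =O[𝓝[>] 0] fun x => x ^ (m + 2) :=
    isBigO_pow_nhdsGT (by omega)
  set F := elemDiff f₀ D₁ A D₂ with hF
  -- Applying `x • A` to the three-node terms yields four-node terms, which the truncation lacks.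
  -- They are `x ^ 4 • w`, within the error since `m ≤ 2`.
  let w : E := u (.small 3) • A (F 3) + u (.small 4) • A (F 4) + u (.small 5) • A (F 5)
    + u (.small 6) • A (F 6) + u (.small 7) • A (F 7)
  have hw : (fun x : ℝ => x ^ 4 • w) =O[𝓝[>] 0] fun x => x ^ (m + 2) := by
    simpa using h4.smul (isBigO_const_const w one_ne_zero _ : (fun _ : ℝ => w) =O[𝓝[>] 0] fun _ => (1 : ℝ))
  refine ((h.clm_isBigO A).add hw).congr_left fun x => ?_
  simp only [bSum_apply, mulA_small, w]
  simp [hF, elemDiff]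
  module

/-- Composition with `h f(y₀ + ·)`, for a function `f` with Taylor expansion
`f₀ + D₁ x + D₂ x x / 2`. -/
theorem IsBSeries.compF {f : E → E} {y₀ : E} {q : ℕ} (hm : m ≤ 2) (hq : m + 1 ≤ q)
    (hT : (fun x => f (y₀ + x) - (f₀ + D₁ x + (1 / 2 : ℝ) • D₂ x x)) =O[𝓝 0]
      fun x => ‖x‖ ^ q)
    (h : IsBSeries (elemDiff f₀ D₁ A D₂) m u v) :
    IsBSeries (elemDiff f₀ D₁ A D₂) (m + 1) (compF u) fun x => x • f (y₀ + v x) := by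
  have h4 : (fun x : ℝ => x ^ 4) =O[𝓝[>] 0] fun x => x ^ (m + 2) :=
    isBigO_pow_nhdsGT (by omega)
  set F := elemDiff f₀ D₁ A D₂ with hF
  have hv := h.isBigO_id
  have hv0 : Tendsto v (𝓝[>] 0) (𝓝 0) :=
    hv.trans_tendsto (tendsto_nhdsWithin_of_tendsto_nhds tendsto_id)
  have hid := isBigO_refl (fun x : ℝ => x) (𝓝[>] 0)
  -- the remainder of the Taylor expansion
  have h1 : (fun x => x • (f (y₀ + v x) - (f₀ + D₁ (v x) + (1 / 2 : ℝ) • D₂ (v x) (v x))))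
      =O[𝓝[>] 0] fun x => x ^ (m + 2) := by
    refine (hid.smul ((hT.comp_tendsto hv0).trans (hv.norm_left.pow q))).trans ?_
    refine (isBigO_pow_nhdsGT (show m + 2 ≤ q + 1 by omega)).congr_left fun x => ?_
    simp only [smul_eq_mul]; ring
  -- the quadratic term
  have hlin : (fun x => v x - x • u (.small 0) • f₀) =O[𝓝[>] 0] fun x => x ^ (min m 1 + 1) := by
    refine ((h.mono (min_le_left m 1)).sub (isBSeries_bSum F (min m 1)
      (fun τ => open Classical in if τ = .small 0 then u τ else 0))).isBigO ?_ |>.congr_left fun x => ?_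
    · intro i hi
      have : i = 0 := by
        rw [TWTree.order_small] at hi
        have key : ∀ i, (![1, 2, 2, 3, 3, 3, 3, 3] : Fin 8 → ℕ) i ≤ 1 → i = 0 := by decide
        exact key i (hi.trans (min_le_right _ _))
      simp [this]
    · simp [bSum_apply, TWTree.small_injective.eq_iff, hF, elemDiff, smul_smul]
  have hvv : (fun x => x • ((1 / 2 : ℝ) • D₂ (v x) (v x))
      - (x ^ 3 * u (.small 0) ^ 2) • (1 / 2 : ℝ) • D₂ f₀ f₀) =O[𝓝[>] 0] fun x => x ^ (m + 2) := by
    have hb := D₂.isBoundedBilinearMap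
    -- With `ℓ` the linear part of `v`, `D₂ v v - D₂ ℓ ℓ = D₂ (v - ℓ) v + D₂ ℓ (v - ℓ)`. Including
    -- the outer factor `x`, the error is `x ^ (min m 1 + 3)`, which suffices exactly because `m ≤
    -- 2`.
    have e1 : (fun x => D₂ (v x - x • u (.small 0) • f₀) (v x)) =O[𝓝[>] 0]
        fun x => x ^ (min m 1 + 1) * x :=
      hb.isBigO_comp.trans (hlin.norm_left.mul hv.norm_left)
    have e2 : (fun x => D₂ (x • u (.small 0) • f₀) (v x - x • u (.small 0) • f₀)) =O[𝓝[>] 0]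
        fun x => x ^ (min m 1 + 1) * x := by
      have hc : (fun x : ℝ => x • u (.small 0) • f₀) =O[𝓝[>] 0] fun x => x := by
        simpa using hid.smul (isBigO_const_const (u (.small 0) • f₀) one_ne_zero _ :
          (fun _ : ℝ => u (.small 0) • f₀) =O[𝓝[>] 0] fun _ => (1 : ℝ))
      exact (hb.isBigO_comp.trans (hc.norm_left.mul hlin.norm_left)).congr_right
        fun x => mul_comm _ _
    have e3 := (hid.const_mul_left (1 / 2)).smul (e1.add e2)
    refine IsBigO.congr_left (e3.trans ?_) fun x => ?_
    · refine (isBigO_pow_nhdsGT (show m + 2 ≤ min m 1 + 3 by omega)).congr_left fun x => ?_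
      simp only [smul_eq_mul]; ring
    · simp
      module
  -- the linear term
  let w : E := u (.small 3) • D₁ (F 3) + u (.small 4) • D₁ (F 4) + u (.small 5) • D₁ (F 5)
    + u (.small 6) • D₁ (F 6) + u (.small 7) • D₁ (F 7)
  have hw : (fun x : ℝ => x ^ 4 • w) =O[𝓝[>] 0] fun x => x ^ (m + 2) := by
    simpa using h4.smul (isBigO_const_const w one_ne_zero _ : (fun _ : ℝ => w) =O[𝓝[>] 0] fun _ => (1 : ℝ))
  refine (((h1.add hvv).add (h.clm_isBigO D₁)).add hw).congr_left fun x => ?_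
  simp only [bSum_apply, compF_small, w]
  simp [hF, elemDiff]
  module

/-- Multiplication by a power series in `h A`. -/
theorem IsBSeries.mulSeries {q : ℕ} (hq : q ≤ 3) {c : ℕ → ℝ} {Φ : ℝ → E →L[ℝ] E}
    (hΦ : (fun x => Φ x - ∑ i ∈ Finset.range 3, c i • (x • A) ^ i) =O[𝓝[>] 0] fun x => x ^ 3)
    (h : IsBSeries (elemDiff f₀ D₁ A D₂) q u v) :
    IsBSeries (elemDiff f₀ D₁ A D₂) q (mulSeries c u) fun x => Φ x (v x) := by
  set F := elemDiff f₀ D₁ A D₂ with hF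
  -- Multiplication by `h A` gains an order but accepts input only up to order 2. For positive `q`
  -- one order is given up first and regained; for `q = 0` the gain is discarded.
  have hA : ∀ {u v}, IsBSeries F q u v → IsBSeries F q (EPIRKW.mulA u) fun x => x • A (v x) := by
    intro u v h
    rcases q with _ | q
    · exact (IsBSeries.mulA (by omega) h).mono (by omega)
    · exact IsBSeries.mulA (by omega) (h.mono (by omega))
  have h1 : (fun x => (Φ x - ∑ i ∈ Finset.range 3, c i • (x • A) ^ i) (v x)) =O[𝓝[>] 0]
      fun x => x ^ (q + 1) := by
    refine (isBoundedBilinearMap_apply.isBigO_comp.trans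
      (hΦ.norm_left.mul h.isBigO_id.norm_left)).trans ?_
    exact (isBigO_pow_nhdsGT (show q + 1 ≤ 4 by omega)).congr_left fun x => by ring
  have h2 := ((h.const_smul (c 0)).add ((hA h).const_smul (c 1))).add ((hA (hA h)).const_smul (c 2))
  have h3 : IsBSeries F q (EPIRKW.mulSeries c u) fun x =>
      c 0 • v x + c 1 • x • A (v x) + c 2 • x • A (x • A (v x)) :=
    h2.congr_coeff fun i => by simp [mulSeries_small]
  refine (h1.add h3).congr_left fun x => ?_
  simp [Finset.sum_range_succ, pow_succ]

end BSeries

/-! ### Taylor expansion of the right-hand side -/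

section Taylor

variable {E G : Type*} [NormedAddCommGroup E] [NormedSpace ℝ E] [NormedAddCommGroup G]
  [NormedSpace ℝ G]

/-- Mean value inequality on the closed ball of radius `‖x‖`, where the derivative is at most `C *
‖x‖ ^ k`. -/
theorem isBigO_norm_pow_succ_of_hasFDerivAt {g : E → G} {g' : E → E →L[ℝ] G} {k : ℕ}
    (hg : ∀ᶠ x in 𝓝 0, HasFDerivAt g (g' x) x) (hg' : g' =O[𝓝 0] fun x => ‖x‖ ^ k)
    (h0 : g 0 = 0) : g =O[𝓝 0] fun x => ‖x‖ ^ (k + 1) := by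
  obtain ⟨C, hC, hb⟩ := hg'.exists_pos
  obtain ⟨ε, hε, hball⟩ := Metric.eventually_nhds_iff_ball.1 (hg.and hb.bound)
  refine IsBigO.of_bound C ?_
  filter_upwards [Metric.ball_mem_nhds (0 : E) hε] with x hx
  have hsub : ∀ z ∈ Metric.closedBall (0 : E) ‖x‖, z ∈ Metric.ball (0 : E) ε := fun z hz => by
    rw [mem_closedBall_zero_iff] at hz
    rw [mem_ball_zero_iff] at hx ⊢
    exact hz.trans_lt hx
  have := (convex_closedBall (0 : E) ‖x‖).norm_image_sub_le_of_norm_hasFDerivWithin_le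
    (f := g) (f' := g') (C := C * ‖x‖ ^ k) (x := 0) (y := x)
    (fun z hz => (hball z (hsub z hz)).1.hasFDerivWithinAt)
    (fun z hz => by
      refine (hball z (hsub z hz)).2.trans ?_
      rw [norm_pow, norm_norm]
      gcongr
      simpa using hz) (by simp) (by simp)
  rw [h0, sub_zero, sub_zero] at this
  rw [norm_pow, norm_norm, pow_succ, ← mul_assoc]
  exact this

theorem ContDiffAt.taylor_one {f : E → G} {y₀ : E} (hf : ContDiffAt ℝ 2 f y₀) :
    (fun x => f (y₀ + x) - (f y₀ + fderiv ℝ f y₀ x)) =O[𝓝 0] fun x => ‖x‖ ^ 2 := by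
  have hd : ContDiffAt ℝ 1 (fderiv ℝ f) y₀ := hf.fderiv_right (by norm_num)
  have hshift : Tendsto (fun x => y₀ + x) (𝓝 0) (𝓝 y₀) := by
    simpa using (continuous_const_add y₀).tendsto 0
  refine isBigO_norm_pow_succ_of_hasFDerivAt (k := 1)
    (g' := fun x => fderiv ℝ f (y₀ + x) - fderiv ℝ f y₀) ?_ ?_ (by simp)
  · have he : ∀ᶠ z in 𝓝 y₀, DifferentiableAt ℝ f z :=
      (hf.eventually (by simp)).mono fun z hz => hz.differentiableAt (by norm_num)
    filter_upwards [hshift.eventually he] with x hx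
    exact ((hasFDerivAt_comp_add_left y₀).2 hx.hasFDerivAt).sub
      ((fderiv ℝ f y₀).hasFDerivAt.const_add (f y₀))
  · have h := (hd.differentiableAt (by norm_num)).isBigO_sub.comp_tendsto hshift
    simpa [Function.comp_def] using h.norm_right

/-- By symmetry of the second derivative, the derivative of the remainder is the first-order
remainder of `fderiv ℝ f`, which `ContDiffAt.taylor_one` bounds by `‖x‖ ^ 2`. -/
theorem ContDiffAt.taylor_two {f : E → G} {y₀ : E} (hf : ContDiffAt ℝ 3 f y₀) :
    (fun x => f (y₀ + x) - (f y₀ + fderiv ℝ f y₀ x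
      + (1 / 2 : ℝ) • fderiv ℝ (fderiv ℝ f) y₀ x x)) =O[𝓝 0] fun x => ‖x‖ ^ 3 := by
  have hd : ContDiffAt ℝ 2 (fderiv ℝ f) y₀ := hf.fderiv_right (by norm_num)
  have hshift : Tendsto (fun x => y₀ + x) (𝓝 0) (𝓝 y₀) := by
    simpa using (continuous_const_add y₀).tendsto 0
  have hsymm : IsSymmSndFDerivAt ℝ f y₀ := hf.isSymmSndFDerivAt (by
    simp only [minSmoothness_of_isRCLikeNormedField]; norm_num)
  refine isBigO_norm_pow_succ_of_hasFDerivAt (k := 2) ?_ (ContDiffAt.taylor_one hd) (by simp)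
  have he : ∀ᶠ z in 𝓝 y₀, DifferentiableAt ℝ f z :=
    (hf.eventually (by simp)).mono fun z hz => hz.differentiableAt (by norm_num)
  filter_upwards [hshift.eventually he] with x hx
  have h2 := (fderiv ℝ (fderiv ℝ f) y₀).hasFDerivAt.clm_apply (hasFDerivAt_id x)
  refine (((hasFDerivAt_comp_add_left y₀).2 hx.hasFDerivAt).sub
    (((fderiv ℝ f y₀).hasFDerivAt.const_add (f y₀)).add (h2.const_smul (1 / 2 : ℝ)))).congr_fderiv ?_
  ext v
  have := hsymm v x
  simp [this]
  module

end Taylor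

/-! ### The exact solution -/

section Exact

variable {E : Type*} [NormedAddCommGroup E] [NormedSpace ℝ E]

theorem isBigO_pow_succ_of_hasDerivWithinAt {w w' : ℝ → E} {δ : ℝ} (hδ : 0 < δ) {k : ℕ}
    (hw : ∀ s ∈ Set.Icc 0 δ, HasDerivWithinAt w (w' s) (Set.Icc 0 δ) s) (h0 : w 0 = 0)
    (hw' : w' =O[𝓝[>] 0] fun s => s ^ k) : w =O[𝓝[>] 0] fun s => s ^ (k + 1) := by
  obtain ⟨C, hC, hb⟩ := hw'.exists_pos
  obtain ⟨ε, hε, hsub⟩ := mem_nhdsGT_iff_exists_Ioo_subset.1 hb.bound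
  refine IsBigO.of_bound C ?_
  filter_upwards [Ioo_mem_nhdsGT (lt_min hδ hε)] with h hh
  have hh0 := hh.1
  have hhδ := hh.2.trans_le (min_le_left _ _)
  have hhε := hh.2.trans_le (min_le_right _ _)
  -- The bound on `w'` is available only at positive times, so the mean value inequality is used on
  -- `[x, h]` with `x > 0`; continuity of `w` at `0` then allows `x → 0`.
  have key : ∀ x ∈ Set.Ioo 0 h, ‖w h - w x‖ ≤ C * h ^ k * h := fun x hx => by
    have hI : Set.Icc x h ⊆ Set.Icc 0 δ := Set.Icc_subset_Icc hx.1.le hhδ.le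
    refine ((convex_Icc x h).norm_image_sub_le_of_norm_hasDerivWithin_le (C := C * h ^ k)
      (fun z hz => (hw z (hI hz)).mono hI) (fun z hz => ?_) (Set.left_mem_Icc.2 hx.2.le)
      (Set.right_mem_Icc.2 hx.2.le)).trans ?_
    · have hz0 : 0 < z := hx.1.trans_le hz.1
      refine (hsub ⟨hz0, hz.2.trans_lt hhε⟩ : ‖w' z‖ ≤ _).trans ?_
      rw [Real.norm_of_nonneg (by positivity)]
      gcongr
      exact hz.2
    · rw [Real.norm_of_nonneg (by linarith [hx.2])]
      gcongr
      linarith [hx.1]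
  have hcont : Tendsto (fun x => ‖w h - w x‖) (𝓝[>] 0) (𝓝 ‖w h - w 0‖) := by
    have := (hw 0 (Set.left_mem_Icc.2 hδ.le)).continuousWithinAt.tendsto.mono_left
      (nhdsWithin_le_of_mem (Icc_mem_nhdsGT hδ) : 𝓝[>] (0 : ℝ) ≤ _)
    exact (tendsto_const_nhds.sub this).norm
  have := le_of_tendsto hcont (by filter_upwards [Ioo_mem_nhdsGT hh0] using key)
  rw [h0, sub_zero] at this
  rwa [Real.norm_of_nonneg (by positivity), pow_succ, ← mul_assoc]

theorem hasDerivAt_bSum (F : Fin 8 → E) (u : Coeff) (s : ℝ) : HasDerivAt (bSum F u)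
    (∑ i, ((TWTree.small i).order * s ^ ((TWTree.small i).order - 1) * u (.small i)) • F i) s :=
  HasDerivAt.fun_sum fun _ _ => ((hasDerivAt_pow _ s).mul_const _).smul_const _

/-- A Picard-type bootstrap: differentiability at `0` gives `w = O(h)`, and each pass through `w' =
f(y₀ + w)` raises the order of the expansion by one. -/
theorem isBSeries_exactCoeff {f : E → E} {w : ℝ → E} {y₀ : E} {D₁ A : E →L[ℝ] E}
    {D₂ : E →L[ℝ] E →L[ℝ] E} {q : ℕ} (hq : q ≤ 3)
    (hT : (fun x => f (y₀ + x) - (f y₀ + D₁ x + (1 / 2 : ℝ) • D₂ x x)) =O[𝓝 0]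
      fun x => ‖x‖ ^ q) {δ : ℝ} (hδ : 0 < δ) (h0 : w 0 = 0)
    (hw : ∀ s ∈ Set.Icc 0 δ, HasDerivWithinAt w (f (y₀ + w s)) (Set.Icc 0 δ) s)
    {m : ℕ} (hm : m ≤ q) : IsBSeries (elemDiff (f y₀) D₁ A D₂) m exactCoeff w := by
  induction m with
  | zero =>
    rw [isBSeries_zero_iff]
    have := (hw 0 (Set.left_mem_Icc.2 hδ.le)).hasFDerivWithinAt.isBigO_sub.mono
      (nhdsWithin_le_of_mem (Icc_mem_nhdsGT hδ) : 𝓝[>] (0 : ℝ) ≤ _)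
    simpa [h0] using this
  | succ m ih =>
    have h1 := (ih (by omega)).compF (by omega) hm hT
    set F := elemDiff (f y₀) D₁ A D₂
    refine isBigO_pow_succ_of_hasDerivWithinAt hδ
      (fun s hs => (hw s hs).sub (hasDerivAt_bSum F exactCoeff s).hasDerivWithinAt)
      (by simp [bSum_apply, h0]) ?_
    -- Division by `s` turns the expansion of `s • f (y₀ + w s)` into one of `w'`; its main part is
    -- the derivative of the truncated series by `order_mul_exactCoeff_small`.
    have h2 := (isBigO_refl (fun s : ℝ => s⁻¹) (𝓝[>] 0)).smul h1
    refine h2.congr' ?_ ?_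
    · filter_upwards [self_mem_nhdsWithin] with s hs
      have hs : s ≠ 0 := ne_of_gt hs
      rw [smul_sub, inv_smul_smul₀ hs, bSum, Finset.smul_sum]
      congr 1
      refine Finset.sum_congr rfl fun i _ => ?_
      rw [smul_smul, ← order_mul_exactCoeff_small]
      congr 1
      obtain ⟨n, hn⟩ := Nat.exists_eq_succ_of_ne_zero (TWTree.order_pos (.small i)).ne'
      rw [hn]
      field_simp
      simp [pow_succ]
      ring
    · filter_upwards [self_mem_nhdsWithin] with s hs
      have hs : s ≠ 0 := ne_of_gt hs
      simp only [smul_eq_mul]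
      field_simp
      ring

end Exact

/-! ### The numerical solution -/

section Phi

variable {N : ℕ}

/-- For `‖X‖ ≤ 1` the tail from the cubic term on is dominated by `‖X‖ ^ 3 * ∑ 1 / i!`, uniformly in
`k`. -/
theorem phi_isBigO (k : ℕ) :
    (fun X : EuclideanSpace ℝ (Fin N) →L[ℝ] EuclideanSpace ℝ (Fin N) =>
      phi k X - ∑ i ∈ Finset.range 3, ((i + k).factorial : ℝ)⁻¹ • X ^ i) =O[𝓝 0]
      fun X => ‖X‖ ^ 3 := by
  have hexp : Summable fun i : ℕ => ((i.factorial : ℝ))⁻¹ := by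
    simpa using Real.summable_pow_div_factorial 1
  refine IsBigO.of_bound (∑' i : ℕ, ((i.factorial : ℝ))⁻¹) ?_
  filter_upwards [Metric.closedBall_mem_nhds 0 one_pos] with X hX
  rw [mem_closedBall_zero_iff] at hX
  have hb : ∀ i : ℕ, ‖((i + 3 + k).factorial : ℝ)⁻¹ • X ^ (i + 3)‖
      ≤ ((i.factorial : ℝ))⁻¹ * ‖X‖ ^ 3 := fun i => by
    rw [norm_smul, norm_inv, Real.norm_natCast]
    have h1 : ‖X ^ (i + 3)‖ ≤ ‖X‖ ^ 3 := (norm_pow_le' X (by omega)).trans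
      (pow_le_pow_of_le_one (norm_nonneg _) hX (by omega))
    have h2 : (i.factorial : ℝ) ≤ (i + 3 + k).factorial := by
      exact_mod_cast Nat.factorial_le (by omega)
    have h3 : (0 : ℝ) < i.factorial := by exact_mod_cast i.factorial_pos
    gcongr
  have hs : Summable fun i : ℕ => ((i + k).factorial : ℝ)⁻¹ • X ^ i :=
    (summable_nat_add_iff 3).1 (.of_norm_bounded (hexp.mul_right _) hb)
  rw [phi, ← hs.sum_add_tsum_nat_add 3, add_sub_cancel_left, norm_pow, norm_norm]
  exact tsum_of_norm_bounded (hexp.hasSum.mul_right _) hb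

theorem sum_smul_smul_pow {ι R : Type*} [Ring R] [Algebra ℝ R] (s : Finset ι) (c d : ι → ℝ)
    (g h : ℝ) (x : R) (i : ℕ) : ∑ k ∈ s, c k • d k • ((g * h) • x) ^ i =
      ((∑ k ∈ s, c k * d k) * g ^ i) • (h • x) ^ i := by
  simp only [Finset.sum_mul, Finset.sum_smul, smul_smul, smul_pow, mul_pow, mul_assoc]

theorem Tableau.psi_isBigO (T : Tableau) (j : Fin 3) (g : ℝ)
    (A : EuclideanSpace ℝ (Fin N) →L[ℝ] EuclideanSpace ℝ (Fin N)) :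
    (fun h : ℝ => T.psi j ((g * h) • A) - ∑ i ∈ Finset.range 3,
      ((∑ k ∈ Finset.Iic j, T.p j k * ((i + (k.val + 1)).factorial : ℝ)⁻¹) * g ^ i) •
        (h • A) ^ i) =O[𝓝[>] 0] fun h => h ^ 3 := by
  have hX : (fun h : ℝ => (g * h) • A) =O[𝓝[>] 0] fun h => h := by
    simpa [mul_comm, smul_smul] using (isBigO_refl (fun x : ℝ => x) (𝓝[>] 0)).smul
      (isBigO_const_const (g • A) one_ne_zero _ : (fun _ : ℝ => g • A) =O[𝓝[>] 0] fun _ => (1 : ℝ))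
  have hX0 : Tendsto (fun h : ℝ => (g * h) • A) (𝓝[>] 0) (𝓝 0) :=
    hX.trans_tendsto (tendsto_nhdsWithin_of_tendsto_nhds tendsto_id)
  have h1 := IsBigO.fun_sum (s := Finset.Iic j) fun k _ =>
    (((phi_isBigO (k.val + 1)).comp_tendsto hX0).trans
      (hX.norm_left.pow 3)).const_smul_left (T.p j k)
  refine h1.congr_left fun h => ?_
  simp only [Tableau.psi, Pi.smul_apply, Function.comp_apply, smul_sub, Finset.sum_sub_distrib,
    Finset.smul_sum]
  rw [Finset.sum_comm]
  congr 1
  exact Finset.sum_congr rfl fun i _ => sum_smul_smul_pow _ _ _ g h A i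

end Phi

namespace Tableau

theorem isBSeries_step (T : Tableau) {N : ℕ}
    {f : EuclideanSpace ℝ (Fin N) → EuclideanSpace ℝ (Fin N)}
    {D₁ A : EuclideanSpace ℝ (Fin N) →L[ℝ] EuclideanSpace ℝ (Fin N)}
    {D₂ : EuclideanSpace ℝ (Fin N) →L[ℝ] EuclideanSpace ℝ (Fin N) →L[ℝ] EuclideanSpace ℝ (Fin N)}
    {y₀ : EuclideanSpace ℝ (Fin N)} {q : ℕ} (hq : q + 1 ≤ 3)
    (hT : (fun x => f (y₀ + x) - (f y₀ + D₁ x + (1 / 2 : ℝ) • D₂ x x)) =O[𝓝 0]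
      fun x => ‖x‖ ^ (q + 1)) :
    IsBSeries (elemDiff (f y₀) D₁ A D₂) (q + 1) T.stepCoeff fun h => T.step f A h y₀ - y₀ := by
  set F := elemDiff (f y₀) D₁ A D₂
  have hpsi : ∀ (j : Fin 3) (g : ℝ) {u v}, IsBSeries F (q + 1) u v →
      IsBSeries F (q + 1) (T.psiCoeff j g u) fun h => T.psi j ((g * h) • A) (v h) :=
    fun j g _ _ h => h.mulSeries hq (T.psi_isBigO j g A)
  have hf : IsBSeries F (q + 1) (EPIRKW.compF 0) fun h => h • f y₀ := by
    simpa using (isBSeries_zero F q).compF (by omega) le_rfl hT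
  have hR : ∀ {u} {Y : ℝ → EuclideanSpace ℝ (Fin N)}, IsBSeries F (q + 1) u (fun h => Y h - y₀) →
      IsBSeries F (q + 1) (compR u) fun h => h • remainder f A y₀ (Y h) := by
    intro u Y h
    -- One order of the stage expansion is dropped because the factor `h` in `h r` restores it.
    refine (((h.mono q.le_succ).compF (by omega) le_rfl hT).sub hf).sub
      ((h.mono q.le_succ).mulA (by omega)) |>.congr_left fun h => ?_
    simp only [remainder, add_sub_cancel, smul_sub]
    rfl
  have h0 : IsBSeries F (q + 1) (compR 0) fun h => h • remainder f A y₀ y₀ :=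
    hR (by simpa using isBSeries_zero F (q + 1))
  have hY₁ : IsBSeries F (q + 1) T.stageCoeff₁ fun h => T.stage₁ f A h y₀ - y₀ := by
    have := (hpsi 0 (T.g 0 0) hf).const_smul (T.a 0 0)
    simpa only [stage₁, stageCoeff₁, add_sub_cancel_left]
  have hd₁ : IsBSeries F (q + 1) T.diffCoeff₁ fun h => h • T.diff₁ f A h y₀ := by
    have := (hR hY₁).sub h0
    simpa only [diff₁, diffCoeff₁, smul_sub]
  have hY₂ : IsBSeries F (q + 1) T.stageCoeff₂ fun h => T.stage₂ f A h y₀ - y₀ := by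
    have := ((hpsi 0 (T.g 1 0) hf).const_smul (T.a 1 0)).add
        ((hpsi 1 (T.g 1 1) hd₁).const_smul (T.a 1 1))
    simpa only [stage₂, stageCoeff₂, add_assoc, add_sub_cancel_left]
  have hd₂ : IsBSeries F (q + 1) T.diffCoeff₂ fun h => h • T.diff₂ f A h y₀ := by
    have := ((hR hY₂).sub (hR hY₁)).sub hd₁
    simpa only [diff₂, diffCoeff₂, smul_sub]
  have := (((hpsi 0 (T.g 2 0) hf).const_smul (T.b 0)).add
    ((hpsi 1 (T.g 2 1) hd₁).const_smul (T.b 1))).add ((hpsi 2 (T.g 2 2) hd₂).const_smul (T.b 2))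
  simpa only [step, stepCoeff, add_assoc, add_sub_cancel_left]

/-- The order conditions imply the order, as long as the derivatives `D₁`, `D₂` in the Taylor
expansion of the right-hand side are the ones that occur in the B-series. -/
theorem step_sub_solution_isBigO (T : Tableau) {N : ℕ}
    {f : EuclideanSpace ℝ (Fin N) → EuclideanSpace ℝ (Fin N)}
    {D₁ A : EuclideanSpace ℝ (Fin N) →L[ℝ] EuclideanSpace ℝ (Fin N)}
    {D₂ : EuclideanSpace ℝ (Fin N) →L[ℝ] EuclideanSpace ℝ (Fin N) →L[ℝ] EuclideanSpace ℝ (Fin N)}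
    {y : ℝ → EuclideanSpace ℝ (Fin N)} {t δ : ℝ} {q : ℕ} (hq : q + 1 ≤ 3)
    (hT : (fun x => f (y t + x) - (f (y t) + D₁ x + (1 / 2 : ℝ) • D₂ x x)) =O[𝓝 0]
      fun x => ‖x‖ ^ (q + 1))
    (hc : T.SatisfiesOrderConditions (q + 1)) (hδ : 0 < δ)
    (hy : ∀ s ∈ Set.Icc t (t + δ), HasDerivWithinAt y (f (y s)) (Set.Icc t (t + δ)) s) :
    (fun h : ℝ => T.step f A h (y t) - y (t + h)) =O[𝓝[>] 0] fun h : ℝ => h ^ (q + 1 + 1) := by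
  have hw : ∀ s ∈ Set.Icc 0 δ, HasDerivWithinAt (fun s => y (t + s) - y t)
      (f (y t + (y (t + s) - y t))) (Set.Icc 0 δ) s := by
    intro s hs
    have hmaps : Set.MapsTo (fun s => t + s) (Set.Icc 0 δ) (Set.Icc t (t + δ)) := fun x hx =>
      ⟨by linarith [hx.1], by linarith [hx.2]⟩
    rw [add_sub_cancel]
    simpa using ((hy (t + s) (hmaps hs)).scomp s
      ((hasDerivWithinAt_id s _).const_add t) hmaps).sub_const (y t)
  have h1 := isBSeries_exactCoeff (A := A) hq hT hδ (by simp) hw le_rfl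
  have h2 := ((T.isBSeries_step (A := A) hq hT).sub h1).isBigO fun i hi => hc _ hi
  simpa using h2

theorem SatisfiesOrderConditions.hasOrder_two {T : Tableau} (hT : T.SatisfiesOrderConditions 2) :
    T.HasOrder 2 := by
  intro N f A y t δ hδ hf hy
  -- `D₂` occurs only in a three-node differential, which is below the accuracy wanted here, so it
  -- may be set to zero and the first-order Taylor expansion suffices.
  refine T.step_sub_solution_isBigO (D₁ := fderiv ℝ f (y t)) (D₂ := 0) (q := 1) (by norm_num)
    ?_ hT hδ hy
  simpa using ContDiffAt.taylor_one hf

theorem SatisfiesOrderConditions.hasOrder_three {T : Tableau}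
    (hT : T.SatisfiesOrderConditions 3) : T.HasOrder 3 := by
  intro N f A y t δ hδ hf hy
  exact T.step_sub_solution_isBigO (q := 2) (by norm_num) (ContDiffAt.taylor_two hf) hT hδ hy

end Tableau

/-! ### The order conditions -/

theorem forall_of_order_le_three {P : TWTree → Prop} (h : ∀ i, P (.small i)) (τ : TWTree)
    (hτ : τ.order ≤ 3) : P τ := by
  obtain ⟨i, rfl⟩ := TWTree.exists_eq_small hτ
  exact h i

theorem forall_of_order_le_two {P : TWTree → Prop} (h : P (.small 0) ∧ P (.small 1) ∧ P (.small 2))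
    (τ : TWTree) (hτ : τ.order ≤ 2) : P τ := by
  obtain ⟨i, rfl⟩ := TWTree.exists_eq_small (hτ.trans (Nat.le_succ 2))
  rw [TWTree.order_small] at hτ
  have key : ∀ i, (![1, 2, 2, 3, 3, 3, 3, 3] : Fin 8 → ℕ) i ≤ 2 → i = 0 ∨ i = 1 ∨ i = 2 := by
    decide
  obtain rfl | rfl | rfl := key i hτ
  exacts [h.1, h.2.1, h.2.2]

namespace Tableau

variable (T : Tableau)

theorem psiCoeff_small (j : Fin 3) (g : ℝ) (u : Coeff) (i : Fin 8) :
    T.psiCoeff j g u (.small i) =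
      (∑ k ∈ Finset.Iic j, T.p j k * ((0 + (k.val + 1)).factorial : ℝ)⁻¹) * g ^ 0 * u (.small i)
      + (∑ k ∈ Finset.Iic j, T.p j k * ((1 + (k.val + 1)).factorial : ℝ)⁻¹) * g ^ 1
        * mulA u (.small i)
      + (∑ k ∈ Finset.Iic j, T.p j k * ((2 + (k.val + 1)).factorial : ℝ)⁻¹) * g ^ 2
        * mulA (mulA u) (.small i) :=
  mulSeries_small u _ i

theorem sum_Iic_zero (c : Fin 3 → ℝ) : ∑ k ∈ Finset.Iic (0 : Fin 3), c k = c 0 := by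
  rw [show Finset.Iic (0 : Fin 3) = {0} by decide]; simp

theorem sum_Iic_one (c : Fin 3 → ℝ) : ∑ k ∈ Finset.Iic (1 : Fin 3), c k = c 0 + c 1 := by
  rw [show Finset.Iic (1 : Fin 3) = {0, 1} by decide]; simp

theorem sum_Iic_two (c : Fin 3 → ℝ) : ∑ k ∈ Finset.Iic (2 : Fin 3), c k = c 0 + c 1 + c 2 := by
  rw [show Finset.Iic (2 : Fin 3) = Finset.univ by decide]; simp [Fin.sum_univ_three]

end Tableau

/-- The residuals of the methods that differ from `epirkw3a` only in the weights. -/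
theorem residual_epirkw3a_withWeights (b : Fin 3 → ℝ) (i : Fin 8) :
    (epirkw3a.withWeights b).residual (.small i) =
      ![4 / 3 * b 0 - 1, 4 / 3 * b 1 - b 2 / 6 - 1 / 2, 2 / 3 * b 0 - 4 / 3 * b 1 + b 2 / 6,
        8 / 9 * b 1 - b 2 / 9 - 1 / 3, b 2 / 6 - 1 / 6, 4 / 9 * b 1 - 2 / 9 * b 2,
        b 1 / 3 - b 2 / 6, 2 / 9 * b 0 - 7 / 9 * b 1 + 2 / 9 * b 2] i := by
  rw [Tableau.residual, exactCoeff_small]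
  fin_cases i <;>
    simp [epirkw3a, Tableau.withWeights, Tableau.stepCoeff, Tableau.diffCoeff₁, Tableau.diffCoeff₂,
      Tableau.stageCoeff₂, compR, Tableau.stageCoeff₁, Tableau.psiCoeff_small, compF_small,
      mulA_small, Tableau.sum_Iic_zero, Tableau.sum_Iic_one, Tableau.sum_Iic_two,
      Nat.factorial] <;>
    ring

theorem epirkw3a_satisfiesOrderConditions : epirkw3a.SatisfiesOrderConditions 3 :=
  forall_of_order_le_three fun i => by
    rw [show epirkw3a = epirkw3a.withWeights epirkw3a.b from rfl, residual_epirkw3a_withWeights]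
    fin_cases i <;> simp [epirkw3a] <;> norm_num

theorem epirkw3aEmbedded_satisfiesOrderConditions (β : ℝ) :
    (epirkw3a.withWeights (epirkw3aEmbedded β)).SatisfiesOrderConditions 2 :=
  forall_of_order_le_two <| by
    simp only [residual_epirkw3a_withWeights, epirkw3aEmbedded]
    -- The three conditions amount to `b 0 = 3 / 4` and `8 * b 1 - b 2 = 3`, hence the one-parameter
    -- family of weights.
    refine ⟨?_, ?_, ?_⟩ <;> simp <;> ring

/-- The tableaux of the shape of `epirkw3b`. -/
def epirkw3bFamily (a₁₁ a₂₁ a₂₂ b₂ b₃ g p : ℝ) : Tableau where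
  a := !![a₁₁, 0, 0; a₂₁, a₂₂, 0]
  b := ![1, b₂, b₃]
  g := !![0, 0, 0; g, g, g; 1, 1, 1]
  p := !![1, 0, 0; 0, p, 0; 1, 1, 1]

/-- The constants come from `ψ₃ = φ₁ + φ₂ + φ₃`: its value at `0` is `1 + 1/2 + 1/6 = 5/3` and its
linear coefficient is `1/2 + 1/6 + 1/24 = 17/24`. For `ψ₂ = p φ₂` the corresponding numbers are `p /
2` and `p / 6`. -/
theorem residual_epirkw3bFamily (a₁₁ a₂₁ a₂₂ b₂ b₃ g p : ℝ) (i : Fin 8) :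
    (epirkw3bFamily a₁₁ a₂₁ a₂₂ b₂ b₃ g p).residual (.small i) =
      ![0, b₂ * p * a₁₁ / 2 + 5 / 3 * b₃ * (a₂₁ - 2 * a₁₁) - 1 / 2,
        1 / 2 - b₂ * p * a₁₁ / 2 - 5 / 3 * b₃ * (a₂₁ - 2 * a₁₁),
        b₂ * p * a₁₁ ^ 2 / 2 + 5 / 3 * b₃ * (a₂₁ ^ 2 - 2 * a₁₁ ^ 2) - 1 / 3,
        5 / 6 * b₃ * a₂₂ * p * a₁₁ - 1 / 6,
        5 / 6 * b₃ * (a₂₁ * g - a₂₂ * p * a₁₁),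
        b₂ * p * a₁₁ / 6 - 5 / 6 * b₃ * a₂₂ * p * a₁₁ + 17 / 24 * b₃ * (a₂₁ - 2 * a₁₁),
        1 / 6 - b₂ * p * a₁₁ / 6 + 5 / 6 * b₃ * a₂₂ * p * a₁₁ - 17 / 24 * b₃ * (a₂₁ - 2 * a₁₁)
          - 5 / 6 * b₃ * a₂₁ * g] i := by
  rw [Tableau.residual, exactCoeff_small]
  fin_cases i <;>
    simp [-mul_eq_zero, -zero_eq_mul, -mul_eq_mul_left_iff, -mul_eq_mul_right_iff, epirkw3bFamily,
      Tableau.stepCoeff, Tableau.diffCoeff₁, Tableau.diffCoeff₂, Tableau.stageCoeff₂, compR,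
      Tableau.stageCoeff₁, Tableau.psiCoeff_small, compF_small, mulA_small, Tableau.sum_Iic_zero,
      Tableau.sum_Iic_one, Tableau.sum_Iic_two, Nat.factorial] <;>
    ring

theorem epirkw3b_withWeights_eq_family (β : ℝ) :
    epirkw3b.withWeights (epirkw3bEmbedded β) = epirkw3bFamily (a₂₁ / 2) a₂₁ a₂₂ b₂ β g₂₁
      (-(4 * a₂₁) / (a₂₂ * (3 * a₂₁ - 4))) := rfl

theorem epirkw3b_eq_family :
    epirkw3b = epirkw3bFamily (a₂₁ / 2) a₂₁ a₂₂ b₂ (-(3 * a₂₁ - 4) / (10 * a₂₁ ^ 2)) g₂₁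
      (-(4 * a₂₁) / (a₂₂ * (3 * a₂₁ - 4))) := rfl

/-- The decimal values of `a₂₁` and `a₂₂` matter only through the nonvanishing of the denominators;
the conditions are identities in these two parameters. -/
theorem epirkw3b_satisfiesOrderConditions : epirkw3b.SatisfiesOrderConditions 3 :=
  forall_of_order_le_three fun i => by
    rw [epirkw3b_eq_family, residual_epirkw3bFamily]
    have h1 : a₂₁ ≠ 0 := by norm_num [a₂₁]
    have h2 : a₂₂ ≠ 0 := by norm_num [a₂₂]
    have h3 : 3 * a₂₁ - 4 ≠ 0 := by norm_num [a₂₁]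
    fin_cases i <;> simp [-mul_eq_zero, b₂, g₂₁] <;> field_simp <;> ring

/-- Up to two nodes the third weight occurs only with the factor `a₂₁ - 2 * a₁₁`, which is zero for
`a₁₁ = a₂₁ / 2`. This leaves `β` free. -/
theorem epirkw3bEmbedded_satisfiesOrderConditions (β : ℝ) :
    (epirkw3b.withWeights (epirkw3bEmbedded β)).SatisfiesOrderConditions 2 :=
  forall_of_order_le_two <| by
    simp only [epirkw3b_withWeights_eq_family, residual_epirkw3bFamily]
    have h1 : a₂₁ ≠ 0 := by norm_num [a₂₁]
    have h2 : a₂₂ ≠ 0 := by norm_num [a₂₂]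
    have h3 : 3 * a₂₁ - 4 ≠ 0 := by norm_num [a₂₁]
    refine ⟨?_, ?_, ?_⟩ <;> simp [-mul_eq_zero, b₂, g₂₁] <;> field_simp <;> ring

/-! ### Rounding errors of the displayed decimals -/

theorem abs_residual_epirkw3bDecimal_le :
    ∀ τ : TWTree, τ.order ≤ 3 → |epirkw3bDecimal.residual τ| ≤ 1 / 10 ^ 14 :=
  forall_of_order_le_three fun i => by
    rw [show epirkw3bDecimal = epirkw3bFamily 0.22824182961171620396 0.45648365922343240794
      0.33161664063356950085 2.0931591383832578214 1.2623969257900804404 0.34706341174296320958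
      2.0931604100438501004 from rfl, residual_epirkw3bFamily, abs_le]
    fin_cases i <;> norm_num

theorem abs_residual_epirkw3bDecimal_withWeights_le :
    ∀ τ : TWTree, τ.order ≤ 2 →
      |(epirkw3bDecimal.withWeights epirkw3bEmbeddedDecimal).residual τ| ≤ 1 / 10 ^ 14 :=
  forall_of_order_le_two <| by
    rw [show epirkw3bDecimal.withWeights epirkw3bEmbeddedDecimal =
      epirkw3bFamily 0.22824182961171620396 0.45648365922343240794 0.33161664063356950085
        2.0931591383832578214 1 0.34706341174296320958 2.0931604100438501004 from rfl]
    simp only [residual_epirkw3bFamily, abs_le, Matrix.cons_val]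
    refine ⟨?_, ?_, ?_⟩ <;> norm_num

theorem epirkw3bDecimal_near : epirkw3bDecimal.Near epirkw3b (1 / 10 ^ 14) := by
  refine ⟨fun i j => ?_, fun j => ?_, fun i j => ?_, fun i j => ?_⟩ <;> try fin_cases i
  all_goals
    fin_cases j <;>
      norm_num [epirkw3bDecimal, epirkw3b, a₂₁, a₂₂, b₂, g₂₁, abs_le]

theorem epirkw3bDecimal_withWeights_near :
    (epirkw3bDecimal.withWeights epirkw3bEmbeddedDecimal).Near
      (epirkw3b.withWeights (epirkw3bEmbedded 1)) (1 / 10 ^ 14) := by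
  refine ⟨epirkw3bDecimal_near.1, fun j => ?_, epirkw3bDecimal_near.2.2⟩
  fin_cases j <;>
    norm_num [Tableau.withWeights, epirkw3bEmbeddedDecimal, epirkw3bEmbedded, a₂₁, a₂₂, b₂, abs_le]

end EPIRKW

theorem mainTheorem8 :
    -- there are eight order conditions up to order three
    Set.ncard {τ : EPIRKW.TWTree | τ.order ≤ 3} = 8 ∧
    -- epirkw3a and its embedded methods
    EPIRKW.epirkw3a.SatisfiesOrderConditions 3 ∧
    EPIRKW.epirkw3a.HasOrder 3 ∧
    (∀ β : ℝ,
      (EPIRKW.epirkw3a.withWeights (EPIRKW.epirkw3aEmbedded β)).SatisfiesOrderConditions 2 ∧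
      (EPIRKW.epirkw3a.withWeights (EPIRKW.epirkw3aEmbedded β)).HasOrder 2) ∧
    -- epirkw3b and its embedded methods
    EPIRKW.epirkw3b.SatisfiesOrderConditions 3 ∧
    EPIRKW.epirkw3b.HasOrder 3 ∧
    (∀ β : ℝ,
      (EPIRKW.epirkw3b.withWeights (EPIRKW.epirkw3bEmbedded β)).SatisfiesOrderConditions 2 ∧
      (EPIRKW.epirkw3b.withWeights (EPIRKW.epirkw3bEmbedded β)).HasOrder 2) ∧
    -- the displayed decimals of epirkw3b
    EPIRKW.epirkw3bDecimal.Near EPIRKW.epirkw3b (1 / 10 ^ 14) ∧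
    (EPIRKW.epirkw3bDecimal.withWeights EPIRKW.epirkw3bEmbeddedDecimal).Near
      (EPIRKW.epirkw3b.withWeights (EPIRKW.epirkw3bEmbedded 1)) (1 / 10 ^ 14) ∧
    (∀ τ : EPIRKW.TWTree, τ.order ≤ 3 → |EPIRKW.epirkw3bDecimal.residual τ| ≤ 1 / 10 ^ 14) ∧
    (∀ τ : EPIRKW.TWTree, τ.order ≤ 2 →
      |(EPIRKW.epirkw3bDecimal.withWeights EPIRKW.epirkw3bEmbeddedDecimal).residual τ|
        ≤ 1 / 10 ^ 14) := by
  open EPIRKW in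
  exact ⟨TWTree.ncard_order_le_three, epirkw3a_satisfiesOrderConditions,
    epirkw3a_satisfiesOrderConditions.hasOrder_three,
    fun β => ⟨epirkw3aEmbedded_satisfiesOrderConditions β,
      (epirkw3aEmbedded_satisfiesOrderConditions β).hasOrder_two⟩,
    epirkw3b_satisfiesOrderConditions, epirkw3b_satisfiesOrderConditions.hasOrder_three,
    fun β => ⟨epirkw3bEmbedded_satisfiesOrderConditions β,
      (epirkw3bEmbedded_satisfiesOrderConditions β).hasOrder_two⟩,
    epirkw3bDecimal_near, epirkw3bDecimal_withWeights_near, abs_residual_epirkw3bDecimal_le,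
    abs_residual_epirkw3bDecimal_withWeights_le⟩
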